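/- Let $a>-1$ and $\theta\in[-1,1]$ be real, let $X_1,X_2,\dots$ be i.i.d. random variables with uniform distribution on $[-a,1]$, and put $p_0^a(\theta):=1$ and $$p_n^a(\theta):=\mathbb P(X_2\ge\theta X_1,\;X_3\ge\theta X_2,\;\dots,\;X_{n+1}\ge\theta X_n),\qquad n\ge1,$$ the persistence probabilities of the MA(1) process $X_{n+1}-\theta X_n$. For $r,z\in\mathbb C$ with $|r|\le 1$ let $$E(r,z):=\sum_{n=0}^\infty\frac{r^{n(n-1)/2}}{n!}z^n ,\qquad 0^0:=1 .$$ **(B)** (blue region) Let $\theta\in[0,1]$ and $a\ge0$, or $\theta\in[-1,0)$ and $a\in[-\theta,-1/\theta]$. Then $$\sum_{n=0}^\infty p_n^a(\theta)z^n=\frac{E\big(\theta,\frac{az}{1+a}\big)-E\big(\theta,\frac{-z}{1+a}\big)}{z\,E\big(\theta,\frac{-z}{1+a}\big)}$$ for every complex $z\ne0$ such that $E(\theta,\frac{-w}{1+a})\neq0$ for all $|w|\le|z|$. **(G)** (green region) Let $\theta\in[-1,0)$ and $a\ge-1/\theta$. Then $$\sum_{n=0}^\infty p_n^a(\theta)z^n=\frac{\theta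 a+1}{\theta(1+a)}+\frac{E\big(\theta,\frac{-z}{\theta(1+a)}\big)-E\big(\theta,\frac{-z}{1+a}\big)}{z\,E\big(\theta,\frac{-z}{1+a}\big)}$$ for every complex $z\ne0$ such that $E(\theta,\frac{-w}{1+a})\neq0$ for all $|w|\le|z|$. **(Y)** (yellow region) Let $\theta\in[-1,0)$ and $a\in[0,-\theta]$, and let $G$ be the meromorphic function $$G(z):=\frac{E\big(\theta,\frac{az}{\theta(1+a)}\big)}{E\big(\theta,\frac{az}{1+a}\big)}-\frac{1+\frac a\theta}{1+a}\,z .$$ For every complex $z$ such that $G$ has no zero in $\{|w|\le|z|\}$, the series $\sum_n p_n^a(\theta)z^n$ converges, and if moreover $z\ne0$ and $E(\theta,\frac{az}{1+a})\ne0$, then $$\sum_{n=0}^\infty p_n^a(\theta)z^n=\frac1z\Big(\frac1{G(z)}-1\Big).$$ **(O)** (orange region) Let $\theta\in(0,1]$ and $-\theta\le a\le0$, $a>-1$. With $x_+:=\max(x,0)$ and $$F(z):=\sum_{i=0}^\infty(-1)^i\frac{(\theta^i+a)_+^{i+1}}{(i+1)!\,\theta^{i(i+1)/2}(1+a)^{i+1}}\,z^i$$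 one has $$\sum_{n=0}^\infty p_n^a(\theta)z^n=\frac{F(z)}{1-zF(z)}$$ for every complex $z$ such that $1-wF(w)\ne0$ for all $|w|\le|z|$. **(W)** (white region) If $-1<a\le\min(-\theta,0)$, then $p_n^a(\theta)=1$ for all $n\ge0$. In (B), (G), (Y), (O) the series on the left converges absolutely. -/

import Mathlib

open MeasureTheory ProbabilityTheory Filter Topology Set

/-- The persistence probability `P(X₁ ≥ θ X₀, X₂ ≥ θ X₁, …, Xₙ ≥ θ Xₙ₋₁)` of the moving average
process of order one with innovations `X₀, X₁, X₂, …`. For `n = 0` the event is the whole space. -/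
noncomputable def persistenceProb {Ω : Type*} [MeasurableSpace Ω] (P : Measure Ω)
    (X : ℕ → Ω → ℝ) (θ : ℝ) (n : ℕ) : ℝ :=
  P.real {ω | ∀ i < n, θ * X i ω ≤ X (i + 1) ω}

/-- The deformed exponential function `E(r, z) = ∑ₙ r^(n(n-1)/2) zⁿ / n!`
(absolutely convergent for every `z` as soon as `|r| ≤ 1`). -/
noncomputable def deformedExp (r z : ℂ) : ℂ :=
  ∑' n : ℕ, r ^ (n * (n - 1) / 2) / (n.factorial : ℂ) * z ^ n

/-- The series `F(z) = ∑ᵢ (-1)^i (θ^i + a)₊^(i+1) / ((i+1)! θ^(i(i+1)/2) (1+a)^(i+1)) z^i`,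
where `x₊ = max x 0`. -/
noncomputable def orangeSeries (θ a : ℝ) (z : ℂ) : ℂ :=
  ∑' i : ℕ, (((-1) ^ i * (max (θ ^ i + a) 0) ^ (i + 1) /
    ((i + 1).factorial * θ ^ (i * (i + 1) / 2) * (1 + a) ^ (i + 1)) : ℝ) : ℂ) * z ^ i

/-- The function `G(z) = E(θ, az/(θ(1+a))) / E(θ, az/(1+a)) - (1 + a/θ)/(1+a) * z`, which is
meromorphic on the complex plane. -/
noncomputable def yellowDenom (θ a : ℝ) (z : ℂ) : ℂ :=
  deformedExp θ (a * z / (θ * (1 + a))) / deformedExp θ (a * z / (1 + a))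
    - (1 + a / θ) / (1 + a) * z

/-!
Let `μ` be the uniform law on `[-a, 1]` and let `fₙ(x)` be the probability of persistence up to time
`n` given `X₀ = x` (`persistFrom`). By independence `f₀ = 1`, `fₙ₊₁(x) = ∫_{y ≥ θx} fₙ(y) dμ(y)`,
and `pₙ = ∫ fₙ dμ` (`persistenceProb_eq_integral`). The proof finds, in each region but the
white one (where all constraints hold almost surely), a formal identity
`N(z) (1 + z ∑ pₙ zⁿ) = D(z)`, in the green one with a linear term added to the series, with entire
`N` and `D`, and then converts it into convergence.

Blue and green regions. On an interval `[L, 1]` that is stable under `x ↦ θx`, the generating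
function `f(x, z) = ∑ fₙ(x) zⁿ` satisfies `f(x) = 1 + z/(1+a) ∫_{θx}^1 f`. Because
`∂E(θ, w)/∂w = E(θ, θw)`, this is solved by `f(x, z) = E(θ, -θxz/(1+a)) / E(θ, -z/(1+a))`, and
integrating once more gives `∑ pₙ zⁿ` (`deformedSeries_mul_persistSeries`).

Yellow region. For `x ≥ -a/θ` the constraint is void, and on `[-a, -a/θ]` the generating function is
a multiple of `E(θ, -θxz/(1+a))`; the multiple is found by matching at `-a/θ`
(`yellow_mul_persistSeries`).

Orange region. Inclusion-exclusion over the violated constraints gives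
`(1 - zF(z)) (1 + z ∑ pₙ zⁿ) = 1` with `F(z) = ∑ (-1)ⁱ qᵢ zⁱ`, where
`qᵢ = P(X₁ < θX₀, …, Xᵢ < θXᵢ₋₁)` (`one_sub_mul_persistSeries`); the `qᵢ` are computed by iterated
integration (`integral_descendTo_cond_Icc`).

Analysis. If `N Q = D` formally and `D / N` has no pole in the closed disc through `z`, then it is
holomorphic on a larger disc, its Taylor series is `Q` because the ring of formal power series is a
domain, and so `Q` converges at `z` (`hasSum_coeff_of_mul_eq`).
-/

/-! ### Quotients of entire power series -/

/-- Two power series with the same sum on a disc have the same coefficients. -/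
theorem eq_of_hasSum_pow {c d : ℕ → ℂ} {f : ℂ → ℂ} {R : ℝ} (hR : 0 < R)
    (hc : ∀ z : ℂ, ‖z‖ < R → HasSum (fun n => c n * z ^ n) (f z))
    (hd : ∀ z : ℂ, ‖z‖ < R → HasSum (fun n => d n * z ^ n) (f z)) : c = d := by
  have key : ∀ e : ℕ → ℂ, (∀ z : ℂ, ‖z‖ < R → HasSum (fun n => e n * z ^ n) (f z)) →
      HasFPowerSeriesAt f (FormalMultilinearSeries.ofScalars ℂ e) 0 := by
    intro e he
    rw [hasFPowerSeriesAt_iff]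
    filter_upwards [Metric.ball_mem_nhds (0 : ℂ) hR] with z hz
    have := he z (by simpa using hz)
    simpa [FormalMultilinearSeries.coeff_ofScalars, mul_comm] using this
  have h := (key c hc).eq_formalMultilinearSeries (key d hd)
  exact FormalMultilinearSeries.ofScalars_series_injective ℂ ℂ h

theorem analyticOnNhd_tsum_pow {c : ℕ → ℂ} (hc : ∀ z : ℂ, Summable fun n => c n * z ^ n) :
    AnalyticOnNhd ℂ (fun z => ∑' n, c n * z ^ n) univ := by
  set p := FormalMultilinearSeries.ofScalars ℂ c with hp
  have hrad : p.radius = ⊤ := by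
    refine FormalMultilinearSeries.radius_eq_top_of_summable_norm _ fun r => ?_
    refine ((hc (r : ℂ)).norm).congr fun n => ?_
    simp [hp]
  have h := p.hasFPowerSeriesOnBall (by simp [hrad])
  have h2 := h.analyticOnNhd
  rw [hrad] at h2
  have : p.sum = fun z => ∑' n, c n * z ^ n := by
    ext z
    simp [hp, FormalMultilinearSeries.sum, mul_comm]
  rw [this] at h2
  simpa using h2

theorem eventually_tsum_pow_ne_zero {c : ℕ → ℂ} (hc : ∀ z : ℂ, Summable fun n => c n * z ^ n)
    (h0 : c 0 ≠ 0) (w : ℂ) : ∀ᶠ u in 𝓝[≠] w, ∑' n, c n * u ^ n ≠ 0 := by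
  have han := analyticOnNhd_tsum_pow hc
  have hne : ∑' n, c n * (0 : ℂ) ^ n ≠ 0 := by
    rw [tsum_eq_single 0 fun n hn => by simp [hn]]
    simpa using h0
  refine (han w trivial).eventually_eq_zero_or_eventually_ne_zero.resolve_left fun h => hne ?_
  exact han.eqOn_zero_of_preconnected_of_eventuallyEq_zero isPreconnected_univ trivial h
    (mem_univ (0 : ℂ))

/-- The passage from a formal identity `N * Q = D` with `N`, `D` entire to convergence of `Q`: the
quotient `D / N` is meromorphic, and since `N / D` does not tend to `0` at any point of the closed
disc through `z`, it has no pole there. Its normal form `h` is therefore holomorphic on a slightly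
larger disc, and the Taylor series of `h` solves the same formal equation as `Q`. Common zeros of
`N` and `D` are allowed, which is why the value `S` is only described by `N z * S = D z`. -/
theorem hasSum_coeff_of_mul_eq {N D Q : PowerSeries ℂ} (hNQ : N * Q = D)
    (hN0 : PowerSeries.coeff 0 N ≠ 0)
    (hN : ∀ z : ℂ, Summable fun n => PowerSeries.coeff n N * z ^ n)
    (hD : ∀ z : ℂ, Summable fun n => PowerSeries.coeff n D * z ^ n) {z : ℂ}
    (hz : ∀ w : ℂ, ‖w‖ ≤ ‖z‖ → ¬ Tendsto (fun u : ℂ => (∑' n, PowerSeries.coeff n N * u ^ n) /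
      ∑' n, PowerSeries.coeff n D * u ^ n) (𝓝[≠] w) (𝓝 0)) :
    ∃ S : ℂ, HasSum (fun n => PowerSeries.coeff n Q * z ^ n) S ∧
      (∑' n, PowerSeries.coeff n N * z ^ n) * S = ∑' n, PowerSeries.coeff n D * z ^ n := by
  set Nf : ℂ → ℂ := fun u => ∑' n, PowerSeries.coeff n N * u ^ n with hNf
  set Df : ℂ → ℂ := fun u => ∑' n, PowerSeries.coeff n D * u ^ n with hDf
  have hNa : AnalyticOnNhd ℂ Nf univ := analyticOnNhd_tsum_pow hN
  have hDa : AnalyticOnNhd ℂ Df univ := analyticOnNhd_tsum_pow hD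
  have hNne : ∀ w, ∀ᶠ u in 𝓝[≠] w, Nf u ≠ 0 := eventually_tsum_pow_ne_zero hN hN0
  have hmer : MeromorphicOn (Df / Nf) univ := fun w _ =>
    (hDa w trivial).meromorphicAt.div (hNa w trivial).meromorphicAt
  set h := toMeromorphicNFOn (Df / Nf) univ with hh
  have hEq : ∀ w, ∀ᶠ u in 𝓝[≠] w, Nf u * h u = Df u := by
    intro w
    have h1 := hmer.toMeromorphicNFOn_eq_self_on_nhdsNE (mem_univ w)
    filter_upwards [h1, hNne w] with u hu hu'
    rw [hh, hu]
    rw [Pi.div_apply, mul_div_cancel₀ _ hu']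
  have han : ∀ w : ℂ, ‖w‖ ≤ ‖z‖ → AnalyticAt ℂ h w := by
    intro w hw
    have hNF : MeromorphicNFAt h w := meromorphicNFOn_toMeromorphicNFOn _ univ (mem_univ w)
    rw [← hNF.meromorphicOrderAt_nonneg_iff_analyticAt, hh,
      meromorphicOrderAt_toMeromorphicNFOn hmer (mem_univ w)]
    by_contra hneg
    push Not at hneg
    apply hz w hw
    have e : (fun u => Nf u / Df u) = (Df / Nf)⁻¹ := by ext u; simp
    rw [e, tendsto_zero_iff_meromorphicOrderAt_pos (hmer w trivial).inv, meromorphicOrderAt_inv]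
    generalize meromorphicOrderAt (Df / Nf) w = o at hneg
    induction o with
    | top => simp at hneg
    | coe k =>
      norm_cast at hneg ⊢
      exact neg_pos.2 hneg
  obtain ⟨δ, hδ, hsub⟩ := (isCompact_closedBall (0 : ℂ) ‖z‖).exists_thickening_subset_open
    (isOpen_analyticAt ℂ h) (fun w hw => han w (by simpa using hw))
  rw [thickening_closedBall hδ (norm_nonneg z)] at hsub
  -- Analyticity is an open condition, so it persists on a disc of radius larger than `‖z‖`.
  set R : NNReal := ⟨‖z‖ + δ / 2, by positivity⟩ with hR
  have hRR : (R : ℝ) = ‖z‖ + δ / 2 := rfl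
  have hdiff : DifferentiableOn ℂ h (Metric.closedBall 0 R) := fun w hw =>
    (hsub (Metric.closedBall_subset_ball (by rw [hRR]; linarith) hw)).differentiableAt
      |>.differentiableWithinAt
  have hRpos : (0 : ℝ) < R := by rw [hRR]; positivity
  have hps := hdiff.hasFPowerSeriesOnBall (by exact_mod_cast hRpos)
  set q : ℕ → ℂ := fun n => (cauchyPowerSeries h 0 R).coeff n with hq
  have hsum : ∀ u : ℂ, ‖u‖ < R → HasSum (fun n => q n * u ^ n) (h u) := by
    intro u hu
    have := hps.hasSum (y := u) (by simpa [enorm_eq_nnnorm] using hu)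
    simpa [hq, mul_comm] using this
  have hND : ∀ u : ℂ, ‖u‖ < R → Nf u * h u = Df u := by
    intro u hu
    have c1 : ContinuousAt (fun u => Nf u * h u) u :=
      ((hNa u trivial).continuousAt).mul
        (hdiff.differentiableAt
          (Metric.closedBall_mem_nhds_of_mem (by simpa using hu))).continuousAt
    have c2 : ContinuousAt Df u := (hDa u trivial).continuousAt
    exact tendsto_nhds_unique ((c1.tendsto.mono_left nhdsWithin_le_nhds).congr' (hEq u))
      (c2.tendsto.mono_left nhdsWithin_le_nhds)
  have hprod : ∀ u : ℂ, ‖u‖ < R →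
      HasSum (fun n => PowerSeries.coeff n (N * PowerSeries.mk q) * u ^ n) (Df u) := by
    intro u hu
    have s1 := (hN u).norm
    have s2 := (hsum u hu).summable.norm
    have s3 := (summable_norm_sum_mul_antidiagonal_of_summable_norm s1 s2).of_norm
    have s4 := tsum_mul_tsum_eq_tsum_sum_antidiagonal_of_summable_norm s1 s2
    rw [(hsum u hu).tsum_eq] at s4
    rw [← hND u hu]
    simp only [hNf]
    rw [s4]
    have e : (fun n => PowerSeries.coeff n (N * PowerSeries.mk q) * u ^ n) = fun n =>
        ∑ kl ∈ Finset.HasAntidiagonal.antidiagonal n,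
          PowerSeries.coeff kl.1 N * u ^ kl.1 * (q kl.2 * u ^ kl.2) := by
      ext n
      rw [PowerSeries.coeff_mul, Finset.sum_mul]
      refine Finset.sum_congr rfl fun ij hij => ?_
      rw [← Finset.HasAntidiagonal.mem_antidiagonal.1 hij, PowerSeries.coeff_mk, pow_add]
      ring
    rw [e]
    exact s3.hasSum
  have hqD : N * PowerSeries.mk q = D := by
    ext n
    exact congrFun (eq_of_hasSum_pow hRpos hprod fun u _ => (hD u).hasSum) n
  have hQ : PowerSeries.mk q = Q := by
    have hN' : N ≠ 0 := by rintro rfl; simp at hN0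
    exact mul_left_cancel₀ hN' (hqD.trans hNQ.symm)
  have hzR : ‖z‖ < R := by rw [hRR]; linarith
  refine ⟨h z, ?_, hND z hzR⟩
  rw [← hQ]
  simpa using hsum z hzR

/-- The version of `hasSum_coeff_of_mul_eq` for a denominator without zeros on the disc. -/
theorem hasSum_coeff_div_of_mul_eq {N D Q : PowerSeries ℂ} (hNQ : N * Q = D)
    (hD0 : PowerSeries.coeff 0 D ≠ 0)
    (hN : ∀ z : ℂ, Summable fun n => PowerSeries.coeff n N * z ^ n)
    (hD : ∀ z : ℂ, Summable fun n => PowerSeries.coeff n D * z ^ n) {z : ℂ}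
    (hz : ∀ w : ℂ, ‖w‖ ≤ ‖z‖ → ∑' n, PowerSeries.coeff n N * w ^ n ≠ 0) :
    HasSum (fun n => PowerSeries.coeff n Q * z ^ n)
      ((∑' n, PowerSeries.coeff n D * z ^ n) / ∑' n, PowerSeries.coeff n N * z ^ n) := by
  have hN0 : PowerSeries.coeff 0 N ≠ 0 := by
    rintro h
    refine hD0 ?_
    simp [← hNQ, PowerSeries.coeff_mul, h]
  obtain ⟨S, hS, hNS⟩ := hasSum_coeff_of_mul_eq hNQ hN0 hN hD (z := z) fun w hw hlim => by
    refine hz w hw ?_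
    have hNc := (analyticOnNhd_tsum_pow hN w trivial).continuousAt.tendsto.mono_left
      (nhdsWithin_le_nhds (s := {w}ᶜ))
    have hDc := (analyticOnNhd_tsum_pow hD w trivial).continuousAt.tendsto.mono_left
      (nhdsWithin_le_nhds (s := {w}ᶜ))
    have h := hlim.mul hDc
    rw [zero_mul] at h
    refine tendsto_nhds_unique hNc (h.congr' ?_)
    filter_upwards [eventually_tsum_pow_ne_zero hD hD0 w] with u hu
    exact div_mul_cancel₀ _ hu
  rwa [← hNS, mul_div_cancel_left₀ _ (hz z le_rfl)]

/-! ### Persistence probabilities as iterated integrals -/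

/-- The conditional persistence probability `P(X₁ ≥ θ X₀, …, Xₙ ≥ θ Xₙ₋₁ | X₀ = x)` when the
innovations have law `μ`, defined by its recursion in `n`. -/
noncomputable def persistFrom (μ : Measure ℝ) (θ : ℝ) : ℕ → ℝ → ℝ
  | 0 => fun _ => 1
  | n + 1 => fun x => ∫ y in Ici (θ * x), persistFrom μ θ n y ∂μ

theorem persistFrom_succ (μ : Measure ℝ) (θ : ℝ) (n : ℕ) (x : ℝ) :
    persistFrom μ θ (n + 1) x = ∫ y in Ici (θ * x), persistFrom μ θ n y ∂μ := rfl

section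
variable {μ : Measure ℝ} [IsProbabilityMeasure μ] {θ : ℝ}

theorem measurable_setIntegral_Ici {f : ℝ → ℝ} (hf : Measurable f) (θ : ℝ) :
    Measurable fun x => ∫ y in Ici (θ * x), f y ∂μ := by
  have h : Measurable (Function.uncurry fun x y : ℝ => (Ici (θ * x)).indicator f y) := by
    have hs : MeasurableSet {p : ℝ × ℝ | θ * p.1 ≤ p.2} :=
      measurableSet_le (measurable_fst.const_mul θ) measurable_snd
    exact (hf.comp measurable_snd).indicator hs
  have := (h.stronglyMeasurable.integral_prod_right (ν := μ)).measurable
  simpa only [integral_indicator measurableSet_Ici] using this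

theorem setIntegral_mem_Icc {f : ℝ → ℝ} (hf : Measurable f) (h : ∀ x, f x ∈ Icc (0 : ℝ) 1)
    (s : Set ℝ) : ∫ y in s, f y ∂μ ∈ Icc (0 : ℝ) 1 := by
  refine ⟨integral_nonneg fun x => (h x).1, ?_⟩
  have h1 : Integrable f (μ.restrict s) := by
    refine Integrable.of_bound hf.aestronglyMeasurable 1 (ae_of_all _ fun x => ?_)
    rw [Real.norm_eq_abs, abs_of_nonneg (h x).1]
    exact (h x).2
  calc ∫ y in s, f y ∂μ ≤ ∫ y in s, 1 ∂μ :=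
        integral_mono h1 (integrable_const _) fun x => (h x).2
    _ ≤ 1 := by simp [measureReal_le_one]

theorem measurable_persistFrom (n : ℕ) : Measurable (persistFrom μ θ n) := by
  induction n with
  | zero => exact measurable_const
  | succ n ih => exact measurable_setIntegral_Ici ih θ

theorem persistFrom_mem_Icc (n : ℕ) (x : ℝ) : persistFrom μ θ n x ∈ Icc (0 : ℝ) 1 := by
  induction n generalizing x with
  | zero => simp [persistFrom]
  | succ n ih => exact setIntegral_mem_Icc (measurable_persistFrom n) ih _

theorem integrable_persistFrom (n : ℕ) : Integrable (persistFrom μ θ n) μ := by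
  refine Integrable.of_bound (measurable_persistFrom n).aestronglyMeasurable 1
    (ae_of_all _ fun x => ?_)
  rw [Real.norm_eq_abs, abs_of_nonneg (persistFrom_mem_Icc n x).1]
  exact (persistFrom_mem_Icc n x).2

variable {Ω : Type*} [MeasurableSpace Ω] {P : Measure Ω} [IsProbabilityMeasure P]
  {X : ℕ → Ω → ℝ}

/-- Integrating out the last innovation: it is independent of all the earlier ones, which are
packed into one random sequence `Z` (padded with zeros from index `n + 1` on). -/
theorem setIntegral_persist_succ (hmeas : ∀ i, Measurable (X i)) (hindep : iIndepFun X P)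
    (hlaw : ∀ i, P.map (X i) = μ) (n : ℕ) {h : ℝ → ℝ} (hh : Measurable h)
    (hb : ∀ x, h x ∈ Icc (0 : ℝ) 1) :
    ∫ ω in {ω | ∀ i < n + 1, θ * X i ω ≤ X (i + 1) ω}, h (X (n + 1) ω) ∂P =
      ∫ ω in {ω | ∀ i < n, θ * X i ω ≤ X (i + 1) ω}, ∫ y in Ici (θ * X n ω), h y ∂μ ∂P := by
  classical
  set T : (Finset.range (n + 1) → ℝ) → ℕ → ℝ := fun v i =>
    if hi : i ∈ Finset.range (n + 1) then v ⟨i, hi⟩ else 0 with hT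
  have hTm : Measurable T := by
    refine measurable_pi_lambda _ fun i => ?_
    simp only [hT]
    split_ifs with hi
    · exact measurable_pi_apply _
    · exact measurable_const
  set Z : Ω → ℕ → ℝ := fun ω => T fun i => X i ω with hZ
  have hZm : Measurable Z := hTm.comp (measurable_pi_lambda _ fun i => hmeas i)
  have hZX : ∀ ω, ∀ i ≤ n, Z ω i = X i ω := by
    intro ω i hi
    simp only [hZ, hT]
    rw [dif_pos (Finset.mem_range.2 (Nat.lt_succ_of_le hi))]
  have hind : IndepFun Z (X (n + 1)) P := by
    have h1 := hindep.indepFun_finset (Finset.range (n + 1)) {n + 1} (by simp) hmeas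
    exact h1.comp hTm (measurable_pi_apply (⟨n + 1, by simp⟩ : ({n + 1} : Finset ℕ)))
  set B : Set (ℕ → ℝ) := {v | ∀ i < n, θ * v i ≤ v (i + 1)} with hB
  have hBm : MeasurableSet B := by
    have : B = ⋂ i ∈ Finset.range n, {v : ℕ → ℝ | θ * v i ≤ v (i + 1)} := by
      ext v; simp [hB]
    rw [this]
    exact Finset.measurableSet_biInter _ fun i _ => measurableSet_le
      (by fun_prop) (by fun_prop)
  have hAZ : {ω | ∀ i < n, θ * X i ω ≤ X (i + 1) ω} = Z ⁻¹' B := by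
    ext ω
    refine forall₂_congr fun i hi => ?_
    rw [hZX ω i hi.le, hZX ω (i + 1) hi]
  set C : Set ((ℕ → ℝ) × ℝ) := {p | p.1 ∈ B ∧ θ * p.1 n ≤ p.2} with hC
  have hCm : MeasurableSet C := (measurable_fst hBm).inter
    (measurableSet_le (by fun_prop) measurable_snd)
  have hAC : {ω | ∀ i < n + 1, θ * X i ω ≤ X (i + 1) ω} =
      (fun ω => (Z ω, X (n + 1) ω)) ⁻¹' C := by
    ext ω
    have h1 : Z ω ∈ B ↔ ∀ i < n, θ * X i ω ≤ X (i + 1) ω := by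
      rw [← mem_preimage, ← hAZ, mem_ofPred_eq]
    simp only [mem_ofPred_eq, mem_preimage, hC, h1, hZX ω n le_rfl]
    exact Nat.forall_lt_succ_right
  have hpm : Measurable fun ω => (Z ω, X (n + 1) ω) := hZm.prodMk (hmeas _)
  have hprod : P.map (fun ω => (Z ω, X (n + 1) ω)) = (P.map Z).prod μ := by
    rw [(indepFun_iff_map_prod_eq_prod_map_map hZm.aemeasurable (hmeas _).aemeasurable).1 hind,
      hlaw]
  have : IsProbabilityMeasure (P.map Z) := Measure.isProbabilityMeasure_map hZm.aemeasurable
  set G : (ℕ → ℝ) × ℝ → ℝ := C.indicator fun p => h p.2 with hG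
  have hGm : Measurable G := (hh.comp measurable_snd).indicator hCm
  have hGi : Integrable G ((P.map Z).prod μ) := by
    refine Integrable.of_bound hGm.aestronglyMeasurable 1 (ae_of_all _ fun p => ?_)
    refine (norm_indicator_le_norm_self _ _).trans ?_
    rw [Real.norm_eq_abs, abs_of_nonneg (hb _).1]
    exact (hb _).2
  have hKm := measurable_setIntegral_Ici (μ := μ) hh θ
  calc _ = ∫ ω, G (Z ω, X (n + 1) ω) ∂P := by
        rw [hAC, ← integral_indicator (hpm hCm)]; rfl
    _ = ∫ v, ∫ y, G (v, y) ∂μ ∂(P.map Z) := by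
        rw [← integral_map hpm.aemeasurable hGm.aestronglyMeasurable, hprod, integral_prod _ hGi]
    _ = ∫ v in B, ∫ y in Ici (θ * v n), h y ∂μ ∂(P.map Z) := by
        rw [← integral_indicator hBm]
        congr 1 with v
        by_cases hv : v ∈ B
        · rw [indicator_of_mem hv, ← integral_indicator measurableSet_Ici]
          congr 1 with y
          by_cases hy : y ∈ Ici (θ * v n)
          · rw [indicator_of_mem hy, hG, indicator_of_mem (show (v, y) ∈ C from ⟨hv, hy⟩)]
          · rw [indicator_of_notMem hy, hG, indicator_of_notMem fun hvy => hy hvy.2]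
        · rw [indicator_of_notMem hv]
          simp [hG, hC, hv]
    _ = _ := by
        have hm : Measurable fun v : ℕ → ℝ => ∫ y in Ici (θ * v n), h y ∂μ :=
          hKm.comp (measurable_pi_apply n)
        rw [setIntegral_map hBm hm.aestronglyMeasurable hZm.aemeasurable, ← hAZ]
        simp only [hZX _ n le_rfl]

theorem setIntegral_persistFrom (hmeas : ∀ i, Measurable (X i)) (hindep : iIndepFun X P)
    (hlaw : ∀ i, P.map (X i) = μ) (n m : ℕ) :
    ∫ ω in {ω | ∀ i < n, θ * X i ω ≤ X (i + 1) ω}, persistFrom μ θ m (X n ω) ∂P =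
      ∫ x, persistFrom μ θ (n + m) x ∂μ := by
  induction n generalizing m with
  | zero =>
    have h := integral_map (μ := P) (hmeas 0).aemeasurable
      (measurable_persistFrom (μ := μ) (θ := θ) m).aestronglyMeasurable
    rw [hlaw 0] at h
    simp [h]
  | succ n ih =>
    rw [setIntegral_persist_succ hmeas hindep hlaw n (measurable_persistFrom m)
      (persistFrom_mem_Icc m), add_right_comm, add_assoc, ← ih]
    rfl

theorem persistenceProb_eq_integral (hmeas : ∀ i, Measurable (X i)) (hindep : iIndepFun X P)
    (hlaw : ∀ i, P.map (X i) = μ) (n : ℕ) :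
    persistenceProb P X θ n = ∫ x, persistFrom μ θ n x ∂μ := by
  have h := setIntegral_persistFrom (θ := θ) hmeas hindep hlaw n 0
  simpa [persistFrom, persistenceProb] using h
end

/-! ### The uniform distribution on `[-a, 1]` -/

section
variable {a : ℝ}

theorem isProbabilityMeasure_cond_Icc (ha : -1 < a) :
    IsProbabilityMeasure (cond volume (Icc (-a) 1) : Measure ℝ) := by
  refine cond_isProbabilityMeasure_of_finite ?_ ?_
  · rw [Real.volume_Icc]
    simpa using by linarith
  · simp

theorem setIntegral_cond_Icc (ha : -1 < a) (f : ℝ → ℝ) {s : Set ℝ} (hs : MeasurableSet s) :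
    ∫ y in s, f y ∂(cond volume (Icc (-a) 1)) = (1 + a)⁻¹ * ∫ y in s ∩ Icc (-a) 1, f y := by
  rw [ProbabilityTheory.cond, Measure.restrict_smul, integral_smul_measure,
    Measure.restrict_restrict hs, Real.volume_Icc, ENNReal.toReal_inv,
    ENNReal.toReal_ofReal (by linarith), smul_eq_mul, sub_neg_eq_add]

theorem setIntegral_Ici_cond_Icc (ha : -1 < a) (f : ℝ → ℝ) {u : ℝ} (hu : u ∈ Icc (-a) 1) :
    ∫ y in Ici u, f y ∂(cond volume (Icc (-a) 1)) = (1 + a)⁻¹ * ∫ y in u..1, f y := by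
  rw [setIntegral_cond_Icc ha f measurableSet_Ici, intervalIntegral.integral_of_le hu.2,
    ← integral_Icc_eq_integral_Ioc]
  congr 3
  ext y
  simp only [mem_inter_iff, mem_Ici, mem_Icc]
  exact ⟨fun h => ⟨h.1, h.2.2⟩, fun h => ⟨h.1, hu.1.trans h.1, h.2⟩⟩

theorem setIntegral_Ioi_cond_Icc (ha : -1 < a) (f : ℝ → ℝ) {u : ℝ} (hu : u ∈ Icc (-a) 1) :
    ∫ y in Ioi u, f y ∂(cond volume (Icc (-a) 1)) = (1 + a)⁻¹ * ∫ y in u..1, f y := by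
  rw [setIntegral_cond_Icc ha f measurableSet_Ioi, intervalIntegral.integral_of_le hu.2]
  congr 3
  ext y
  simp only [mem_inter_iff, mem_Ioi, mem_Icc, mem_Ioc]
  exact ⟨fun h => ⟨h.1, h.2.2⟩, fun h => ⟨h.1, hu.1.trans h.1.le, h.2⟩⟩

theorem integral_cond_Icc (ha : -1 < a) (f : ℝ → ℝ) :
    ∫ y, f y ∂(cond volume (Icc (-a) 1)) = (1 + a)⁻¹ * ∫ y in (-a)..1, f y := by
  rw [← setIntegral_univ, setIntegral_cond_Icc ha f MeasurableSet.univ, univ_inter,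
    intervalIntegral.integral_of_le (by linarith), integral_Icc_eq_integral_Ioc]

theorem setIntegral_Ici_cond_Icc_of_le (ha : -1 < a) (f : ℝ → ℝ) {u : ℝ} (hu : u ≤ -a) :
    ∫ y in Ici u, f y ∂(cond volume (Icc (-a) 1)) = ∫ y, f y ∂(cond volume (Icc (-a) 1)) := by
  rw [setIntegral_cond_Icc ha f measurableSet_Ici, integral_cond_Icc ha,
    intervalIntegral.integral_of_le (by linarith), ← integral_Icc_eq_integral_Ioc,
    inter_eq_right.2 (Icc_subset_Ici_self.trans (Ici_subset_Ici.2 hu))]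

theorem setIntegral_Ici_cond_Icc_of_one_le (ha : -1 < a) (f : ℝ → ℝ) {u : ℝ} (hu : 1 ≤ u) :
    ∫ y in Ici u, f y ∂(cond volume (Icc (-a) 1)) = 0 := by
  rw [setIntegral_cond_Icc ha f measurableSet_Ici, setIntegral_measure_zero, mul_zero]
  refine measure_mono_null (fun y hy => ?_) (measure_singleton (1 : ℝ))
  exact le_antisymm hy.2.2 (hu.trans hy.1)

theorem setIntegral_Ioi_cond_Icc_of_one_le (ha : -1 < a) (f : ℝ → ℝ) {u : ℝ} (hu : 1 ≤ u) :
    ∫ y in Ioi u, f y ∂(cond volume (Icc (-a) 1)) = 0 := by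
  rw [setIntegral_cond_Icc ha f measurableSet_Ioi, setIntegral_measure_zero, mul_zero]
  refine measure_mono_null (fun y hy => ?_) (measure_singleton (1 : ℝ))
  exact le_antisymm hy.2.2 (hu.trans (le_of_lt hy.1))
end

/-! ### The deformed exponential as a formal power series -/

/-- The Taylor series of `z ↦ E(r, c z)` at the origin, with real `r` and `c`. -/
noncomputable def deformedSeries (r c : ℝ) : PowerSeries ℝ :=
  .mk fun k => r ^ (k * (k - 1) / 2) / (k.factorial : ℝ) * c ^ k

theorem triangle_succ (k : ℕ) : (k + 1) * (k + 1 - 1) / 2 = k * (k - 1) / 2 + k := by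
  rw [← Nat.choose_two_right, ← Nat.choose_two_right, Nat.choose_succ_succ' k 1,
    Nat.choose_one_right, add_comm]

/-- The functional equation `∂E(r, w)/∂w = E(r, r w)`, read coefficientwise in `z` for
`A(z) E(r, s t z)` as a function of `t`. The factor `z` produced by differentiation shifts the
index of the coefficient. -/
theorem hasDerivAt_deformedSeries (A : PowerSeries ℝ) (r s t : ℝ) (n : ℕ) :
    HasDerivAt (fun t => PowerSeries.coeff (n + 1) (A * deformedSeries r (s * t)))
      (s * PowerSeries.coeff n (A * deformedSeries r (s * (r * t)))) t := by
  simp only [PowerSeries.coeff_mul, Finset.Nat.sum_antidiagonal_succ', Finset.mul_sum]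
  have h0 : HasDerivAt (fun t => PowerSeries.coeff (n + 1) A *
      PowerSeries.coeff 0 (deformedSeries r (s * t))) 0 t := by
    simpa [deformedSeries] using hasDerivAt_const t (PowerSeries.coeff (n + 1) A)
  rw [← zero_add (Finset.sum _ _)]
  refine h0.add (HasDerivAt.fun_sum fun ij _ => ?_)
  simp only [deformedSeries, PowerSeries.coeff_mk]
  have h1 := (((hasDerivAt_id t).const_mul s).pow (ij.2 + 1)).const_mul
    (PowerSeries.coeff ij.1 A *
      (r ^ ((ij.2 + 1) * (ij.2 + 1 - 1) / 2) / ((ij.2 + 1).factorial : ℝ)))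
  refine (h1.congr_deriv ?_).congr_of_eventuallyEq (Eventually.of_forall fun t => ?_)
  · rw [triangle_succ, pow_add, Nat.factorial_succ]
    have := Nat.factorial_ne_zero ij.2
    push_cast
    simp only [id, mul_pow]
    field_simp
  · simp [mul_assoc]

theorem integral_deformedSeries (A : PowerSeries ℝ) (r s u v : ℝ) (n : ℕ) :
    s * ∫ t in u..v, PowerSeries.coeff n (A * deformedSeries r (s * (r * t))) =
      PowerSeries.coeff (n + 1) (A * deformedSeries r (s * v)) -
        PowerSeries.coeff (n + 1) (A * deformedSeries r (s * u)) := by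
  rw [← intervalIntegral.integral_const_mul]
  refine intervalIntegral.integral_eq_sub_of_hasDerivAt
    (f := fun t => PowerSeries.coeff (n + 1) (A * deformedSeries r (s * t)))
    (fun t _ => hasDerivAt_deformedSeries A r s t n) (Continuous.intervalIntegrable ?_ _ _)
  simp only [PowerSeries.coeff_mul, deformedSeries, PowerSeries.coeff_mk]
  fun_prop

@[simp] theorem constantCoeff_deformedSeries (r c : ℝ) :
    PowerSeries.constantCoeff (deformedSeries r c) = 1 := by
  rw [← PowerSeries.coeff_zero_eq_constantCoeff_apply]
  simp [deformedSeries]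

theorem coeff_zero_mul_deformedSeries (A : PowerSeries ℝ) (r c : ℝ) :
    PowerSeries.coeff 0 (A * deformedSeries r c) = PowerSeries.coeff 0 A := by
  simp

/-! ### Formal identities in the blue, green and yellow regions -/

/-- The formal power series `1 + z ∑ₙ pₙ zⁿ`, where `pₙ` are the persistence probabilities for
innovations of law `μ`. The constant term `1` plays the role of a probability with index `-1`, which
makes the identities below hold for all coefficients at once. -/
noncomputable def persistSeries (μ : Measure ℝ) (θ : ℝ) : PowerSeries ℝ :=
  1 + PowerSeries.X * .mk fun n => ∫ x, persistFrom μ θ n x ∂μ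

@[simp] theorem coeff_zero_persistSeries (μ : Measure ℝ) (θ : ℝ) :
    PowerSeries.coeff 0 (persistSeries μ θ) = 1 := by
  simp [persistSeries]

@[simp] theorem coeff_succ_persistSeries (μ : Measure ℝ) (θ : ℝ) (n : ℕ) :
    PowerSeries.coeff (n + 1) (persistSeries μ θ) = ∫ x, persistFrom μ θ n x ∂μ := by
  simp [persistSeries, PowerSeries.coeff_succ_X_mul, PowerSeries.coeff_one]

theorem intervalIntegrable_persistFrom {μ : Measure ℝ} [IsProbabilityMeasure μ] {θ : ℝ} (n : ℕ)
    (u v : ℝ) : IntervalIntegrable (persistFrom μ θ n) volume u v := by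
  refine (intervalIntegrable_const (c := (1 : ℝ))).mono_fun
    (measurable_persistFrom n).aestronglyMeasurable (ae_of_all _ fun x => ?_)
  have h := persistFrom_mem_Icc (μ := μ) (θ := θ) n x
  simpa [abs_of_nonneg h.1] using h.2

theorem deformedSeries_inv_mul (r c : ℝ) : (deformedSeries r c)⁻¹ * deformedSeries r c = 1 :=
  PowerSeries.inv_mul_cancel _ (by simp)

/-- If `x ↦ θ x` maps `[L, 1]` to itself, then on `[L, 1]` the generating function of the
conditional persistence probabilities is `E(θ, -θxz/(1+a)) / E(θ, -z/(1+a))`. If moreover `θ x ≥ 1`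
on `[-a, L)`, then a chain started there stops at once almost surely, and only `p₀` sees this part
of the interval: this is the linear term subtracted on the left. -/
theorem deformedSeries_mul_persistSeries {θ a L : ℝ} (ha : -1 < a) (hL : -a ≤ L) (hL1 : L ≤ 1)
    (hmap : ∀ x ∈ Icc L 1, θ * x ∈ Icc L 1) (hout : ∀ x ∈ Ico (-a) L, 1 ≤ θ * x) :
    deformedSeries θ (-(1 + a)⁻¹) *
      (persistSeries (cond volume (Icc (-a) 1)) θ -
        PowerSeries.C ((L + a) / (1 + a)) * PowerSeries.X) =
      deformedSeries θ (-(1 + a)⁻¹ * L) := by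
  have := isProbabilityMeasure_cond_Icc ha
  set μ : Measure ℝ := cond volume (Icc (-a) 1) with hμ
  set s : ℝ := -(1 + a)⁻¹ with hs
  set A : PowerSeries ℝ := (deformedSeries θ s)⁻¹ with hA
  have hAS : A * deformedSeries θ (s * 1) = 1 := by
    rw [mul_one]; exact deformedSeries_inv_mul θ s
  have hA0 : PowerSeries.coeff 0 A = 1 := by
    rw [← coeff_zero_mul_deformedSeries A θ (s * 1), hAS, PowerSeries.coeff_zero_one]
  have hA0' : PowerSeries.constantCoeff A = 1 := by simpa using hA0
  -- The antiderivative vanishes at `1` in all degrees above `0`, because `A * E(θ, s z) = 1`.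
  have hint : ∀ n, ∀ u ∈ Icc L 1,
      (∀ x ∈ Icc L 1, persistFrom μ θ n x =
        PowerSeries.coeff n (A * deformedSeries θ (s * (θ * x)))) →
      (1 + a)⁻¹ * ∫ y in u..1, persistFrom μ θ n y =
        PowerSeries.coeff (n + 1) (A * deformedSeries θ (s * u)) := by
    intro n u hu hf
    have h := integral_deformedSeries A θ s u 1 n
    rw [hAS, PowerSeries.coeff_one, if_neg n.succ_ne_zero, zero_sub] at h
    rw [intervalIntegral.integral_congr (g := fun x =>
      PowerSeries.coeff n (A * deformedSeries θ (s * (θ * x)))) fun x hx => hf x ?_]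
    · rw [hs] at h ⊢; linarith
    · rw [uIcc_of_le hu.2] at hx
      exact ⟨hu.1.trans hx.1, hx.2⟩
  have hf : ∀ n, ∀ x ∈ Icc L 1, persistFrom μ θ n x =
      PowerSeries.coeff n (A * deformedSeries θ (s * (θ * x))) := by
    intro n
    induction n with
    | zero =>
      intro x hx
      rw [coeff_zero_mul_deformedSeries, hA0, persistFrom]
    | succ n ih =>
      intro x hx
      have hx' := hmap x hx
      rw [persistFrom_succ, setIntegral_Ici_cond_Icc ha _ ⟨hL.trans hx'.1, hx'.2⟩, hint n _ hx' ih]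
  have hQ : persistSeries μ θ = A * deformedSeries θ (s * L) +
      PowerSeries.C ((L + a) / (1 + a)) * PowerSeries.X := by
    ext n
    cases n with
    | zero => simp [hA0']
    | succ n =>
      rw [coeff_succ_persistSeries, integral_cond_Icc ha, map_add, PowerSeries.coeff_C_mul,
        PowerSeries.coeff_X, ← hint n L ⟨le_rfl, hL1⟩ (hf n),
        ← intervalIntegral.integral_add_adjacent_intervals
          (intervalIntegrable_persistFrom n (-a) L) (intervalIntegrable_persistFrom n L 1),
        mul_add, add_comm]
      congr 1
      cases n with
      | zero => simp [persistFrom]; ring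
      | succ n =>
        rw [if_neg (by omega), mul_zero, intervalIntegral.integral_of_le hL,
          ← integral_Ico_eq_integral_Ioc, setIntegral_congr_fun (g := fun _ => 0)
          measurableSet_Ico fun x hx => ?_]
        · simp
        · exact setIntegral_Ici_cond_Icc_of_one_le ha _ (hout x hx)
  rw [hQ, add_sub_cancel_right, ← mul_assoc, mul_comm (deformedSeries θ s), hA,
    deformedSeries_inv_mul, one_mul]

/-- For `θ < 0` and `0 ≤ a ≤ -θ`, put `b = -a/θ`. A chain started in `[b, 1]` has no constraint on
its next step, while `x ↦ θ x` maps `[-a, b]` to itself. On `[-a, b]` the generating function of the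
conditional persistence probabilities is therefore `A(z) E(θ, -θxz/(1+a))`, and matching at `b`
determines `A` by `A(z) E(θ, az/(1+a)) = 1 + z ∑ pₙ zⁿ`. -/
theorem yellow_mul_persistSeries {θ a : ℝ} (hθ : θ ∈ Ico (-1 : ℝ) 0) (ha : a ∈ Icc 0 (-θ)) :
    (deformedSeries θ (a / (θ * (1 + a))) - PowerSeries.C ((1 + a / θ) / (1 + a)) * PowerSeries.X *
        deformedSeries θ (a / (1 + a))) * persistSeries (cond volume (Icc (-a) 1)) θ =
      deformedSeries θ (a / (1 + a)) := by
  obtain ⟨hθ1, hθ0⟩ := hθ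
  obtain ⟨ha0, haθ⟩ := ha
  have ha : -1 < a := by linarith
  have := isProbabilityMeasure_cond_Icc ha
  set μ : Measure ℝ := cond volume (Icc (-a) 1) with hμ
  set s : ℝ := -(1 + a)⁻¹ with hs
  set b : ℝ := -a / θ with hb
  have hbθ : θ * b = -a := by rw [hb, mul_div_cancel₀ _ hθ0.ne]
  have hb0 : 0 ≤ b := div_nonneg_of_nonpos (by linarith) hθ0.le
  have hb1 : b ≤ 1 := by rw [hb, div_le_one_of_neg hθ0]; linarith
  have e1 : a / (1 + a) = s * -a := by rw [hs]; ring
  have e2 : a / (θ * (1 + a)) = s * b := by rw [hs, hb]; field_simp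
  set Q := persistSeries μ θ with hQ
  set A : PowerSeries ℝ := Q * (deformedSeries θ (s * -a))⁻¹ with hA
  have hAS : A * deformedSeries θ (s * -a) = Q := by
    rw [hA, mul_assoc, deformedSeries_inv_mul, mul_one]
  have hA0 : PowerSeries.coeff 0 A = 1 := by
    rw [← coeff_zero_mul_deformedSeries A θ (s * -a), hAS, hQ, coeff_zero_persistSeries]
  have hA0' : PowerSeries.constantCoeff A = 1 := by simpa using hA0
  have hint : ∀ n, ∀ u ∈ Icc (-a) b,
      (∀ x ∈ Icc (-a) b, persistFrom μ θ n x =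
        PowerSeries.coeff n (A * deformedSeries θ (s * (θ * x)))) →
      (1 + a)⁻¹ * ∫ y in (-a)..u, persistFrom μ θ n y = PowerSeries.coeff (n + 1) Q -
        PowerSeries.coeff (n + 1) (A * deformedSeries θ (s * u)) := by
    intro n u hu hf
    have h := integral_deformedSeries A θ s (-a) u n
    rw [hAS] at h
    rw [intervalIntegral.integral_congr (g := fun x =>
      PowerSeries.coeff n (A * deformedSeries θ (s * (θ * x)))) fun x hx => hf x ?_]
    · rw [hs] at h ⊢; linarith
    · rw [uIcc_of_le hu.1] at hx
      exact ⟨hx.1, hx.2.trans hu.2⟩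
  have hf : ∀ n, ∀ x ∈ Icc (-a) b, persistFrom μ θ n x =
      PowerSeries.coeff n (A * deformedSeries θ (s * (θ * x))) := by
    intro n
    induction n with
    | zero =>
      intro x hx
      rw [coeff_zero_mul_deformedSeries, hA0, persistFrom]
    | succ n ih =>
      intro x hx
      have h1 : -a ≤ θ * x := hbθ ▸ mul_le_mul_of_nonpos_left hx.2 hθ0.le
      have h2 : θ * x ≤ b := by
        rw [hb, le_div_iff_of_neg hθ0]
        nlinarith [mul_le_mul_of_nonpos_left hx.1 hθ0.le]
      have h3 := hint n _ ⟨h1, h2⟩ ih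
      have h4 := intervalIntegral.integral_add_adjacent_intervals
        (intervalIntegrable_persistFrom (μ := μ) (θ := θ) n (-a) (θ * x))
        (intervalIntegrable_persistFrom n (θ * x) 1)
      have h5 : PowerSeries.coeff (n + 1) Q = _ :=
        (coeff_succ_persistSeries μ θ n).trans (integral_cond_Icc ha _)
      rw [persistFrom_succ, setIntegral_Ici_cond_Icc ha _ ⟨h1, h2.trans hb1⟩]
      rw [← h4, mul_add] at h5
      linarith
  have hfQ : ∀ n, ∀ x ∈ Icc b 1, persistFrom μ θ n x = PowerSeries.coeff n Q := by
    intro n x hx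
    cases n with
    | zero => rw [hQ, coeff_zero_persistSeries, persistFrom]
    | succ n =>
      rw [hQ, coeff_succ_persistSeries, persistFrom_succ, setIntegral_Ici_cond_Icc_of_le ha]
      exact hbθ ▸ mul_le_mul_of_nonpos_left hx.1 hθ0.le
  -- The coefficients of this identity compare `pₙ` with `∫ fₙ`, the integral being split at `b`.
  have hone : A * deformedSeries θ (s * b) -
      PowerSeries.C ((1 + a / θ) / (1 + a)) * PowerSeries.X * Q = 1 := by
    ext n
    cases n with
    | zero => simp [hA0', mul_assoc]
    | succ n =>
      have h3 := hint n b ⟨by linarith, le_rfl⟩ (hf n)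
      have h4 := intervalIntegral.integral_add_adjacent_intervals
        (intervalIntegrable_persistFrom (μ := μ) (θ := θ) n (-a) b)
        (intervalIntegrable_persistFrom n b 1)
      have h5 : PowerSeries.coeff (n + 1) Q = _ :=
        (coeff_succ_persistSeries μ θ n).trans (integral_cond_Icc ha _)
      have h6 : ∫ x in b..1, persistFrom μ θ n x = (1 - b) * PowerSeries.coeff n Q := by
        rw [intervalIntegral.integral_congr (g := fun _ => PowerSeries.coeff n Q) fun x hx =>
          hfQ n x (by rwa [uIcc_of_le hb1] at hx)]
        simp
      rw [← h4, mul_add, h3, h6] at h5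
      rw [map_sub, mul_assoc (PowerSeries.C _), PowerSeries.coeff_C_mul,
        PowerSeries.coeff_succ_X_mul, PowerSeries.coeff_one, if_neg n.succ_ne_zero]
      have h7 : (1 + a / θ) / (1 + a) = (1 + a)⁻¹ * (1 - b) := by rw [hb]; ring
      rw [h7]
      linarith
  rw [e1, e2, ← hAS]
  calc _ = deformedSeries θ (s * -a) * (A * deformedSeries θ (s * b) -
      PowerSeries.C ((1 + a / θ) / (1 + a)) * PowerSeries.X *
        (A * deformedSeries θ (s * -a))) := by ring
    _ = _ := by rw [hAS, hone, mul_one]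

/-! ### Orange region: inclusion-exclusion over descending chains -/

/-- The probability that `X₁ < θ X₀, …, Xᵢ₋₁ < θ Xᵢ₋₂, y < θ Xᵢ₋₁` for innovations of law `μ`, that
is, that the chain of reversed inequalities holds and can be continued with the value `y`. -/
noncomputable def descendTo (μ : Measure ℝ) (θ : ℝ) : ℕ → ℝ → ℝ
  | 0 => fun _ => 1
  | i + 1 => fun y => ∫ x in {x | y < θ * x}, descendTo μ θ i x ∂μ

theorem descendTo_succ (μ : Measure ℝ) (θ : ℝ) (i : ℕ) (y : ℝ) :
    descendTo μ θ (i + 1) y = ∫ x in {x | y < θ * x}, descendTo μ θ i x ∂μ := rfl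

section
variable {μ : Measure ℝ} [IsProbabilityMeasure μ] {θ : ℝ}

theorem measurableSet_lt_mul (y : ℝ) : MeasurableSet {x : ℝ | y < θ * x} :=
  measurableSet_lt measurable_const (measurable_id.const_mul θ)

theorem measurable_descendTo (i : ℕ) : Measurable (descendTo μ θ i) := by
  induction i with
  | zero => exact measurable_const
  | succ i ih =>
    have hs : MeasurableSet {p : ℝ × ℝ | p.1 < θ * p.2} :=
      measurableSet_lt measurable_fst (measurable_snd.const_mul θ)
    have h : Measurable (Function.uncurry fun y x : ℝ =>
        {x | y < θ * x}.indicator (descendTo μ θ i) x) :=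
      (ih.comp measurable_snd).indicator hs
    have := (h.stronglyMeasurable.integral_prod_right (ν := μ)).measurable
    simp only [integral_indicator (measurableSet_lt_mul _)] at this
    exact this

theorem descendTo_mem_Icc (i : ℕ) (x : ℝ) : descendTo μ θ i x ∈ Icc (0 : ℝ) 1 := by
  induction i generalizing x with
  | zero => simp [descendTo]
  | succ i ih => exact setIntegral_mem_Icc (measurable_descendTo i) ih _

theorem integrable_descendTo (i : ℕ) : Integrable (descendTo μ θ i) μ := by
  refine Integrable.of_bound (measurable_descendTo i).aestronglyMeasurable 1
    (ae_of_all _ fun x => ?_)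
  rw [Real.norm_eq_abs, abs_of_nonneg (descendTo_mem_Icc i x).1]
  exact (descendTo_mem_Icc i x).2

/-- The chain descends for `i` steps and then persists for `n + 1` steps. Dropping the first of the
persistence conditions makes the two parts independent; the excess is the event on which the chain
descends for `i + 1` steps and then persists for `n`. -/
theorem integral_descendTo_mul_persistFrom_succ (i n : ℕ) :
    ∫ x, descendTo μ θ i x * persistFrom μ θ (n + 1) x ∂μ =
      (∫ x, descendTo μ θ i x ∂μ) * (∫ x, persistFrom μ θ n x ∂μ) -
        ∫ x, descendTo μ θ (i + 1) x * persistFrom μ θ n x ∂μ := by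
  set g := descendTo μ θ i
  set f := persistFrom μ θ n
  have hs : MeasurableSet {p : ℝ × ℝ | p.2 < θ * p.1} :=
    measurableSet_lt measurable_snd (measurable_fst.const_mul θ)
  have hgf : Integrable (fun p : ℝ × ℝ => g p.1 * f p.2) (μ.prod μ) :=
    (integrable_descendTo i).mul_prod (integrable_persistFrom n)
  set G : ℝ × ℝ → ℝ := {p : ℝ × ℝ | p.2 < θ * p.1}.indicator fun p => g p.1 * f p.2 with hG
  have hGi : Integrable G (μ.prod μ) := hgf.indicator hs
  have hcompl : ∀ x, persistFrom μ θ (n + 1) x = (∫ y, f y ∂μ) - ∫ y in Iio (θ * x), f y ∂μ := by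
    intro x
    have := integral_add_compl (measurableSet_Ici (a := θ * x))
      (integrable_persistFrom (μ := μ) (θ := θ) n)
    rw [compl_Ici] at this
    exact eq_sub_of_add_eq this
  have hGx : ∀ x, ∫ y, G (x, y) ∂μ = g x * ∫ y in Iio (θ * x), f y ∂μ := by
    intro x
    rw [← integral_const_mul, ← integral_indicator measurableSet_Iio]
    rfl
  have hGy : ∀ y, ∫ x, G (x, y) ∂μ = descendTo μ θ (i + 1) y * f y := by
    intro y
    rw [descendTo_succ, ← integral_mul_const, ← integral_indicator (measurableSet_lt_mul y)]
    rfl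
  have hi := hGi.integral_prod_left
  simp only [hGx] at hi
  simp only [hcompl, mul_sub]
  rw [integral_sub ((integrable_descendTo i).mul_const _) hi, integral_mul_const]
  congr 1
  simp only [← hGx, ← hGy]
  exact integral_integral_swap hGi

theorem integral_descendTo_mul_persistFrom (n i : ℕ) :
    ∫ x, descendTo μ θ i x * persistFrom μ θ n x ∂μ =
      ∑ kj ∈ Finset.HasAntidiagonal.antidiagonal n, (-1) ^ kj.1 *
        (∫ x, descendTo μ θ (i + kj.1) x ∂μ) * PowerSeries.coeff kj.2 (persistSeries μ θ) := by
  induction n generalizing i with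
  | zero => simp [persistFrom]
  | succ n ih =>
    rw [integral_descendTo_mul_persistFrom_succ, ih, Finset.Nat.sum_antidiagonal_succ,
      coeff_succ_persistSeries, sub_eq_add_neg, ← Finset.sum_neg_distrib]
    simp only [pow_zero, one_mul, add_zero]
    congr 1
    refine Finset.sum_congr rfl fun kj _ => ?_
    rw [add_right_comm i 1 kj.1, ← add_assoc, pow_succ]
    ring

/-- `(1 - z F(z)) (1 + z ∑ pₙ zⁿ) = 1`, where `F` is the alternating generating function of the
probabilities of descending chains. This holds for innovations of any law. -/
theorem one_sub_mul_persistSeries :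
    (1 - PowerSeries.X * .mk fun i => (-1) ^ i * ∫ x, descendTo μ θ i x ∂μ) *
      persistSeries μ θ = 1 := by
  rw [sub_mul, one_mul, sub_eq_iff_eq_add, mul_assoc]
  ext n
  cases n with
  | zero => simp
  | succ n =>
    have h := integral_descendTo_mul_persistFrom (μ := μ) (θ := θ) n 0
    simp only [descendTo, one_mul, zero_add] at h
    rw [coeff_succ_persistSeries, map_add, PowerSeries.coeff_succ_X_mul, PowerSeries.coeff_one,
      if_neg n.succ_ne_zero, zero_add, PowerSeries.coeff_mul, h]
    simp only [PowerSeries.coeff_mk]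
end

/-- The condition for `i = 0` is needed because `max (c - x) 0 ^ 0 = 1` also for `x > c`. -/
theorem integral_max_sub_pow {c u : ℝ} (hc : c ≤ 1) (hu : u ≤ 1) (i : ℕ) (hi : i = 0 → c = 1) :
    ∫ x in u..1, max (c - x) 0 ^ i = max (c - u) 0 ^ (i + 1) / (i + 1) := by
  have hzero : ∀ v, c ≤ v → v ≤ 1 → ∫ x in v..1, max (c - x) 0 ^ i = 0 := by
    intro v hv hv1
    rcases Nat.eq_zero_or_pos i with h0 | h0
    · obtain rfl : v = 1 := le_antisymm hv1 (hi h0 ▸ hv)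
      simp
    · rw [intervalIntegral.integral_congr (g := fun _ => 0) fun x hx => ?_]
      · simp
      · rw [uIcc_of_le hv1] at hx
        have : max (c - x) 0 = 0 := max_eq_right (by linarith [hx.1])
        simp [this, h0.ne']
  rcases le_total c u with h | h
  · rw [hzero u h hu, max_eq_right (by linarith), zero_pow i.succ_ne_zero, zero_div]
  · have hcont : Continuous fun x : ℝ => max (c - x) 0 ^ i := by fun_prop
    rw [← intervalIntegral.integral_add_adjacent_intervals (hcont.intervalIntegrable u c)
      (hcont.intervalIntegrable c 1), hzero c le_rfl hc, add_zero,
      intervalIntegral.integral_congr (g := fun x => (c - x) ^ i) fun x hx => ?_,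
      intervalIntegral.integral_comp_sub_left (fun x => x ^ i), integral_pow,
      max_eq_left (by linarith)]
    · simp
    · rw [uIcc_of_le h] at hx
      have : max (c - x) 0 = c - x := max_eq_left (by linarith [hx.2])
      simp [this]

/-- Since `-a ≥ 0`, one has `y / θ ≥ y ≥ -a`: the lower end of the interval never cuts the domain of
integration, and the recursion integrates from `y / θ` to `1`. -/
theorem descendTo_cond_Icc {θ a : ℝ} (hθ : θ ∈ Ioc (0 : ℝ) 1) (ha : -1 < a) (ha0 : a ≤ 0) (i : ℕ)
    {y : ℝ} (hy : -a ≤ y) : descendTo (cond volume (Icc (-a) 1)) θ i y =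
      max (θ ^ i - y) 0 ^ i / (i.factorial * θ ^ (i * (i + 1) / 2) * (1 + a) ^ i) := by
  obtain ⟨hθ0, hθ1⟩ := hθ
  have ha1 : 0 < 1 + a := by linarith
  induction i generalizing y with
  | zero => simp [descendTo]
  | succ i ih =>
    have hset : {x : ℝ | y < θ * x} = Ioi (y / θ) := by
      ext x; simp [div_lt_iff₀' hθ0]
    rw [descendTo_succ, hset]
    rcases le_total 1 (y / θ) with h | h
    · rw [setIntegral_Ioi_cond_Icc_of_one_le ha _ h, max_eq_right, zero_pow i.succ_ne_zero,
        zero_div]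
      rw [le_div_iff₀ hθ0] at h
      have : θ ^ (i + 1) ≤ θ := pow_le_of_le_one hθ0.le hθ1 i.succ_ne_zero
      linarith
    · have hyθ : -a ≤ y / θ := hy.trans (le_div_self (by linarith) hθ0 hθ1)
      rw [setIntegral_Ioi_cond_Icc ha _ ⟨hyθ, h⟩, intervalIntegral.integral_congr
        fun x hx => ih (y := x) (by rw [uIcc_of_le h] at hx; exact hyθ.trans hx.1),
        intervalIntegral.integral_div, integral_max_sub_pow (pow_le_one₀ hθ0.le hθ1) h i
        fun h0 => by rw [h0, pow_zero]]
      have e : max (θ ^ i - y / θ) 0 = max (θ ^ (i + 1) - y) 0 / θ := by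
        rw [← max_div_div_right hθ0.le, zero_div, sub_div, pow_succ,
          mul_div_cancel_right₀ _ hθ0.ne']
      have et : (i + 1) * (i + 1 + 1) / 2 = i * (i + 1) / 2 + (i + 1) := by
        have := triangle_succ (i + 1)
        simp only [Nat.add_sub_cancel] at this
        rw [mul_comm i, ← this, mul_comm]
      rw [e, et, pow_add, Nat.factorial_succ, div_pow]
      have := Nat.factorial_ne_zero i
      push_cast
      field_simp
      ring

theorem integral_descendTo_cond_Icc {θ a : ℝ} (hθ : θ ∈ Ioc (0 : ℝ) 1) (ha : -1 < a) (ha0 : a ≤ 0)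
    (i : ℕ) : ∫ x, descendTo (cond volume (Icc (-a) 1)) θ i x ∂(cond volume (Icc (-a) 1)) =
      max (θ ^ i + a) 0 ^ (i + 1) /
        ((i + 1).factorial * θ ^ (i * (i + 1) / 2) * (1 + a) ^ (i + 1)) := by
  have ha1 : 0 < 1 + a := by linarith
  rw [integral_cond_Icc ha, intervalIntegral.integral_congr fun x hx =>
    descendTo_cond_Icc hθ ha ha0 i (y := x)
      (by rw [uIcc_of_le (by linarith)] at hx; exact hx.1),
    intervalIntegral.integral_div, integral_max_sub_pow (pow_le_one₀ hθ.1.le hθ.2) (by linarith) i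
    fun h0 => by rw [h0, pow_zero], sub_neg_eq_add, Nat.factorial_succ]
  have := Nat.factorial_ne_zero i
  have := hθ.1.ne'
  push_cast
  field_simp
  ring

/-! ### From formal identities to sums of power series -/

theorem deformedSeries_coeff_mul_pow (r c : ℝ) (z : ℂ) (n : ℕ) :
    PowerSeries.coeff n (PowerSeries.map Complex.ofRealHom (deformedSeries r c)) * z ^ n =
      (r : ℂ) ^ (n * (n - 1) / 2) / (n.factorial : ℂ) * (c * z) ^ n := by
  simp [deformedSeries, mul_pow, mul_assoc]

theorem constantCoeff_map_deformedSeries (r c : ℝ) : PowerSeries.constantCoeff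
    (PowerSeries.map Complex.ofRealHom (deformedSeries r c)) = 1 := by
  rw [← PowerSeries.coeff_zero_eq_constantCoeff_apply, PowerSeries.coeff_map]
  simp

theorem hasSum_deformedSeries {r : ℝ} (hr : |r| ≤ 1) (c : ℝ) (z : ℂ) :
    HasSum (fun n => PowerSeries.coeff n
      (PowerSeries.map Complex.ofRealHom (deformedSeries r c)) * z ^ n)
      (deformedExp r (c * z)) := by
  simp only [deformedSeries_coeff_mul_pow]
  refine Summable.hasSum (Summable.of_norm_bounded (Real.summable_pow_div_factorial ‖c * z‖)
    fun n => ?_)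
  rw [norm_mul, norm_div, norm_pow, norm_pow, Complex.norm_natCast, Complex.norm_real,
    Real.norm_eq_abs, div_mul_eq_mul_div]
  gcongr
  exact mul_le_of_le_one_left (by positivity) (pow_le_one₀ (abs_nonneg r) hr)

theorem hasSum_coeff_X_mul {A : PowerSeries ℂ} {z S : ℂ}
    (h : HasSum (fun n => PowerSeries.coeff n A * z ^ n) S) :
    HasSum (fun n => PowerSeries.coeff n (PowerSeries.X * A) * z ^ n) (z * S) := by
  rw [← hasSum_nat_add_iff' 1]
  simp only [PowerSeries.coeff_succ_X_mul]
  simpa [pow_succ', mul_left_comm] using h.mul_left z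

theorem hasSum_coeff_C_mul {A : PowerSeries ℂ} {z S : ℂ} (c : ℂ)
    (h : HasSum (fun n => PowerSeries.coeff n A * z ^ n) S) :
    HasSum (fun n => PowerSeries.coeff n (PowerSeries.C c * A) * z ^ n) (c * S) := by
  simpa [mul_assoc] using h.mul_left c

theorem hasSum_coeff_one (z : ℂ) :
    HasSum (fun n => PowerSeries.coeff n (1 : PowerSeries ℂ) * z ^ n) 1 := by
  convert hasSum_single (f := fun n => PowerSeries.coeff n (1 : PowerSeries ℂ) * z ^ n) 0
    fun n hn => by simp [PowerSeries.coeff_one, hn] using 1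
  simp

theorem hasSum_integral_persistFrom {μ : Measure ℝ} {θ : ℝ} {z S : ℂ} (hz : z ≠ 0)
    (h : HasSum (fun n => PowerSeries.coeff n
      (PowerSeries.map Complex.ofRealHom (persistSeries μ θ)) * z ^ n) S) :
    HasSum (fun n => ((∫ x, persistFrom μ θ n x ∂μ : ℝ) : ℂ) * z ^ n) ((S - 1) / z) := by
  rw [← hasSum_nat_add_iff' 1] at h
  simp only [PowerSeries.coeff_map, coeff_succ_persistSeries, Complex.ofRealHom_eq_coe,
    Finset.range_one, Finset.sum_singleton, coeff_zero_persistSeries, Complex.ofReal_one, pow_zero,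
    mul_one] at h
  simpa only [pow_succ, ← mul_assoc, mul_div_cancel_right₀ _ hz] using h.div_const z

/-- The blue region is the case `L = -a`, the green region the case `L = 1/θ`. -/
theorem hasSum_persist_of_invariant {θ a L : ℝ} (hθ : |θ| ≤ 1) (ha : -1 < a) (hL : -a ≤ L)
    (hL1 : L ≤ 1) (hmap : ∀ x ∈ Icc L 1, θ * x ∈ Icc L 1) (hout : ∀ x ∈ Ico (-a) L, 1 ≤ θ * x)
    {z : ℂ} (hz0 : z ≠ 0) (hz : ∀ w : ℂ, ‖w‖ ≤ ‖z‖ → deformedExp θ (-w / (1 + a)) ≠ 0) :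
    HasSum (fun n => ((∫ x, persistFrom (cond volume (Icc (-a) 1)) θ n x
        ∂(cond volume (Icc (-a) 1)) : ℝ) : ℂ) * z ^ n)
      ((L + a) / (1 + a) + (deformedExp θ (-(L * z) / (1 + a)) - deformedExp θ (-z / (1 + a))) /
        (z * deformedExp θ (-z / (1 + a)))) := by
  set μ : Measure ℝ := cond volume (Icc (-a) 1)
  have e1 : ∀ w : ℂ, ((-(1 + a)⁻¹ : ℝ) : ℂ) * w = -w / (1 + a) := fun w => by
    push_cast; ring
  have e2 : ((-(1 + a)⁻¹ * L : ℝ) : ℂ) * z = -(L * z) / (1 + a) := by push_cast; ring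
  have hmul := congrArg (PowerSeries.map Complex.ofRealHom)
    (deformedSeries_mul_persistSeries ha hL hL1 hmap hout)
  rw [map_mul] at hmul
  have hN := fun w => hasSum_deformedSeries hθ (-(1 + a)⁻¹) w
  have hD := fun w => hasSum_deformedSeries hθ (-(1 + a)⁻¹ * L) w
  have h := hasSum_coeff_div_of_mul_eq hmul (by simp) (fun w => (hN w).summable)
    (fun w => (hD w).summable) (z := z) fun w hw => by
      rw [(hN w).tsum_eq, e1]; exact hz w hw
  rw [(hN z).tsum_eq, (hD z).tsum_eq, e1, e2] at h
  have hX := hasSum_coeff_C_mul (((L + a) / (1 + a) : ℝ) : ℂ)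
    (hasSum_coeff_X_mul (hasSum_coeff_one z))
  have hQ := h.add hX
  simp only [← add_mul, ← map_add] at hQ
  have hfin := hasSum_integral_persistFrom (μ := μ) (θ := θ) hz0 (S := _) (by
    convert hQ using 4
    simp [μ])
  convert hfin using 1
  have hne := hz z le_rfl
  generalize deformedExp θ (-z / (1 + a)) = E at hne
  push_cast
  field_simp
  ring

theorem abs_orange_coeff_le {θ a : ℝ} (hθ : θ ∈ Ioc (0 : ℝ) 1) (ha : -1 < a) (ha0 : a ≤ 0)
    (i : ℕ) : |(-1) ^ i * (max (θ ^ i + a) 0 ^ (i + 1) /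
      ((i + 1).factorial * θ ^ (i * (i + 1) / 2) * (1 + a) ^ (i + 1)))| ≤
      (1 + a)⁻¹ * ((1 + a)⁻¹ ^ i / i.factorial) := by
  obtain ⟨hθ0, hθ1⟩ := hθ
  have ha1 : 0 < 1 + a := by linarith
  have hmax : max (θ ^ i + a) 0 ^ (i + 1) ≤ θ ^ (i * (i + 1) / 2) := by
    calc max (θ ^ i + a) 0 ^ (i + 1) ≤ (θ ^ i) ^ (i + 1) := by
          gcongr
          exact max_le (by linarith) (by positivity)
      _ = θ ^ (i * (i + 1)) := by rw [pow_mul]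
      _ ≤ _ := pow_le_pow_of_le_one hθ0.le hθ1 (Nat.div_le_self _ _)
  rw [abs_mul, abs_pow, abs_neg, abs_one, one_pow, one_mul, abs_of_nonneg (by positivity)]
  calc _ ≤ θ ^ (i * (i + 1) / 2) /
        ((i.factorial : ℝ) * θ ^ (i * (i + 1) / 2) * (1 + a) ^ (i + 1)) := by
        gcongr
        omega
    _ = _ := by
        have := Nat.factorial_ne_zero i
        rw [pow_succ (1 + a), inv_pow]
        field_simp

theorem hasSum_orangeSeries {θ a : ℝ} (hθ : θ ∈ Ioc (0 : ℝ) 1) (ha : -1 < a) (ha0 : a ≤ 0)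
    (z : ℂ) : HasSum (fun n => PowerSeries.coeff n (PowerSeries.map Complex.ofRealHom
      (.mk fun i => (-1) ^ i * ∫ x, descendTo (cond volume (Icc (-a) 1)) θ i x
        ∂(cond volume (Icc (-a) 1)))) * z ^ n) (orangeSeries θ a z) := by
  have e : orangeSeries θ a z = ∑' n, PowerSeries.coeff n (PowerSeries.map Complex.ofRealHom
      (.mk fun i => (-1) ^ i * ∫ x, descendTo (cond volume (Icc (-a) 1)) θ i x
        ∂(cond volume (Icc (-a) 1)))) * z ^ n := by
    refine tsum_congr fun i => ?_
    rw [PowerSeries.coeff_map, PowerSeries.coeff_mk, integral_descendTo_cond_Icc hθ ha ha0,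
      mul_div_assoc]
    rfl
  rw [e]
  refine Summable.hasSum (Summable.of_norm_bounded
    ((Real.summable_pow_div_factorial ((1 + a)⁻¹ * ‖z‖)).mul_left (1 + a)⁻¹) fun i => ?_)
  rw [PowerSeries.coeff_map, PowerSeries.coeff_mk, integral_descendTo_cond_Icc hθ ha ha0,
    norm_mul, norm_pow, Complex.ofRealHom_eq_coe, Complex.norm_real, Real.norm_eq_abs]
  refine (mul_le_mul_of_nonneg_right (abs_orange_coeff_le hθ ha ha0 i) (by positivity)).trans_eq ?_
  rw [mul_pow]
  ring

theorem hasSum_persist_orange {θ a : ℝ} (hθ : θ ∈ Ioc (0 : ℝ) 1) (ha : -1 < a) (ha0 : a ≤ 0)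
    {z : ℂ} (hz : ∀ w : ℂ, ‖w‖ ≤ ‖z‖ → 1 - w * orangeSeries θ a w ≠ 0) :
    HasSum (fun n => ((∫ x, persistFrom (cond volume (Icc (-a) 1)) θ n x
        ∂(cond volume (Icc (-a) 1)) : ℝ) : ℂ) * z ^ n)
      (orangeSeries θ a z / (1 - z * orangeSeries θ a z)) := by
  have := isProbabilityMeasure_cond_Icc ha
  set μ : Measure ℝ := cond volume (Icc (-a) 1) with hμ
  have hF := hasSum_orangeSeries hθ ha ha0
  rcases eq_or_ne z 0 with rfl | hz0
  · have h1 : orangeSeries θ a 0 = 1 := by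
      rw [orangeSeries, tsum_eq_single 0 fun n hn => by simp [hn]]
      have : (1 + a : ℂ) ≠ 0 := by exact_mod_cast (by linarith : 1 + a ≠ 0)
      simp [max_eq_left (by linarith : 0 ≤ 1 + a), this]
    convert hasSum_single (f := fun n => ((∫ x, persistFrom μ θ n x ∂μ : ℝ) : ℂ) * 0 ^ n) 0
      fun n hn => by simp [hn] using 1
    simp [h1, persistFrom]
  · have hmul := congrArg (PowerSeries.map Complex.ofRealHom)
      (one_sub_mul_persistSeries (μ := μ) (θ := θ))
    rw [map_mul, map_sub, map_mul, PowerSeries.map_X, map_one] at hmul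
    have hN := fun w => (hasSum_coeff_one w).sub (hasSum_coeff_X_mul (hF w))
    simp only [← sub_mul, ← map_sub] at hN
    have h := hasSum_coeff_div_of_mul_eq hmul (by simp) (fun w => (hN w).summable)
      (fun w => (hasSum_coeff_one w).summable) (z := z) fun w hw => by
        rw [(hN w).tsum_eq]; exact hz w hw
    rw [(hN z).tsum_eq, (hasSum_coeff_one z).tsum_eq] at h
    convert hasSum_integral_persistFrom hz0 h using 1
    have hne := hz z le_rfl
    rw [div_sub_one hne, sub_sub_cancel, div_div, mul_comm _ z, mul_div_mul_left _ _ hz0]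

/-- `yellowDenom` agrees with the quotient `N / D` of the formal identity wherever `D` does not
vanish, in particular on punctured neighbourhoods of every point. -/
theorem hasSum_persist_yellow {θ a : ℝ} (hθ : θ ∈ Ico (-1 : ℝ) 0) (ha : a ∈ Icc 0 (-θ)) {z : ℂ}
    (hz0 : z ≠ 0)
    (hz : ∀ w : ℂ, ‖w‖ ≤ ‖z‖ → ¬ Tendsto (yellowDenom θ a) (𝓝[≠] w) (𝓝 0)) :
    ∃ S : ℂ, HasSum (fun n => ((∫ x, persistFrom (cond volume (Icc (-a) 1)) θ n x
        ∂(cond volume (Icc (-a) 1)) : ℝ) : ℂ) * z ^ n) S ∧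
      (deformedExp θ (a * z / (1 + a)) ≠ 0 → S = 1 / z * (1 / yellowDenom θ a z - 1)) := by
  have hθ1 : |θ| ≤ 1 := abs_le.2 ⟨hθ.1, by linarith [hθ.2]⟩
  have e1 : ∀ w : ℂ, ((a / (θ * (1 + a)) : ℝ) : ℂ) * w = a * w / (θ * (1 + a)) := fun w => by
    push_cast; ring
  have e2 : ∀ w : ℂ, ((a / (1 + a) : ℝ) : ℂ) * w = a * w / (1 + a) := fun w => by
    push_cast; ring
  have hD := fun w => hasSum_deformedSeries hθ1 (a / (1 + a)) w
  have hmul := congrArg (PowerSeries.map Complex.ofRealHom) (yellow_mul_persistSeries hθ ha)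
  rw [map_mul, map_sub, mul_assoc, map_mul, map_mul, PowerSeries.map_X, PowerSeries.map_C,
    Complex.ofRealHom_eq_coe] at hmul
  have hN := fun w => (hasSum_deformedSeries hθ1 (a / (θ * (1 + a))) w).sub
    (hasSum_coeff_C_mul (((1 + a / θ) / (1 + a) : ℝ) : ℂ) (hasSum_coeff_X_mul (hD w)))
  simp only [← sub_mul, ← map_sub] at hN
  simp only [e1, e2] at hN hD
  have hquot : ∀ w : ℂ, deformedExp θ (a * w / (1 + a)) ≠ 0 → yellowDenom θ a w =
      (deformedExp θ (a * w / (θ * (1 + a))) - (((1 + a / θ) / (1 + a) : ℝ) : ℂ) *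
        (w * deformedExp θ (a * w / (1 + a)))) / deformedExp θ (a * w / (1 + a)) := by
    intro w hw
    rw [yellowDenom, sub_div, ← mul_assoc, mul_div_cancel_right₀ _ hw]
    push_cast
    rfl
  obtain ⟨S, hS, hNS⟩ := hasSum_coeff_of_mul_eq hmul (by simp [constantCoeff_map_deformedSeries])
    (fun w => (hN w).summable) (fun w => (hD w).summable) (z := z) fun w hw hlim => hz w hw <| by
      refine hlim.congr' ?_
      filter_upwards [eventually_tsum_pow_ne_zero (fun w => (hD w).summable) (by simp) w] with u hu
      rw [(hD u).tsum_eq] at hu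
      rw [(hD u).tsum_eq, (hN u).tsum_eq, hquot u hu]
  refine ⟨_, hasSum_integral_persistFrom hz0 hS, fun hne => ?_⟩
  rw [(hN z).tsum_eq, (hD z).tsum_eq] at hNS
  have hN0 := left_ne_zero_of_mul (hNS.trans_ne hne)
  rw [hquot z hne, one_div_div, eq_div_of_mul_eq hN0 ((mul_comm _ _).trans hNS)]
  ring

theorem persistenceProb_eq_one_of_le {Ω : Type*} [MeasurableSpace Ω] (P : Measure Ω)
    [IsProbabilityMeasure P] (X : ℕ → Ω → ℝ) (θ a : ℝ) (hmeas : ∀ i, Measurable (X i))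
    (hunif : ∀ i, pdf.IsUniform (X i) (Icc (-a) 1) P volume) (ha : a ≤ min (-θ) 0) (n : ℕ) :
    persistenceProb P X θ n = 1 := by
  have hmem : ∀ᵐ ω ∂P, ∀ i, X i ω ∈ Icc (-a) 1 := by
    refine ae_all_iff.2 fun i => ?_
    have h : ∀ᵐ x ∂(cond volume (Icc (-a) 1) : Measure ℝ), x ∈ Icc (-a) 1 :=
      ae_cond_mem measurableSet_Icc
    rw [← (hunif i : P.map (X i) = _)] at h
    exact ae_of_ae_map (hmeas i).aemeasurable h
  have hae : ∀ᵐ ω ∂P, ω ∈ {ω | ∀ i < n, θ * X i ω ≤ X (i + 1) ω} := by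
    filter_upwards [hmem] with ω hω i _
    have h0 := hω i
    have h1 := (hω (i + 1)).1
    have ha1 := ha.trans (min_le_left _ _)
    have ha2 := ha.trans (min_le_right _ _)
    rcases le_total 0 θ with h | h
    · nlinarith [mul_le_mul_of_nonneg_left h0.2 h]
    · nlinarith [mul_nonneg (neg_nonneg.2 h) ((neg_nonneg.2 ha2).trans h0.1)]
  have huniv : {ω | ∀ i < n, θ * X i ω ≤ X (i + 1) ω} =ᵐ[P] univ := eventuallyEq_univ.2 hae
  rw [persistenceProb, measureReal_congr huniv, probReal_univ]

/-! ### The generating functions in the five regions -/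

theorem theorem1 {Ω : Type*} [MeasurableSpace Ω] (P : Measure Ω) [IsProbabilityMeasure P]
    (X : ℕ → Ω → ℝ) (θ a : ℝ) (ha : -1 < a)
    (hmeas : ∀ i, Measurable (X i))
    (hindep : iIndepFun X P)
    (hunif : ∀ i, pdf.IsUniform (X i) (Icc (-a) 1) P volume) :
    -- blue region
    ((θ ∈ Icc 0 1 ∧ 0 ≤ a) ∨ (θ ∈ Ico (-1) 0 ∧ a ∈ Icc (-θ) (-1 / θ)) →
      ∀ z : ℂ, z ≠ 0 → (∀ w : ℂ, ‖w‖ ≤ ‖z‖ → deformedExp θ (-w / (1 + a)) ≠ 0) →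
        HasSum (fun n : ℕ => (persistenceProb P X θ n : ℂ) * z ^ n)
          ((deformedExp θ (a * z / (1 + a)) - deformedExp θ (-z / (1 + a))) /
            (z * deformedExp θ (-z / (1 + a))))) ∧
    -- green region
    (θ ∈ Ico (-1) 0 ∧ -1 / θ ≤ a →
      ∀ z : ℂ, z ≠ 0 → (∀ w : ℂ, ‖w‖ ≤ ‖z‖ → deformedExp θ (-w / (1 + a)) ≠ 0) →
        HasSum (fun n : ℕ => (persistenceProb P X θ n : ℂ) * z ^ n)
          ((θ * a + 1) / (θ * (1 + a)) +
            (deformedExp θ (-z / (θ * (1 + a))) - deformedExp θ (-z / (1 + a))) /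
              (z * deformedExp θ (-z / (1 + a))))) ∧
    -- yellow region; zeros of the meromorphic function `yellowDenom θ a` are the points at which
    -- it has limit 0
    (θ ∈ Ico (-1) 0 ∧ a ∈ Icc 0 (-θ) →
      ∀ z : ℂ, (∀ w : ℂ, ‖w‖ ≤ ‖z‖ → ¬ Tendsto (yellowDenom θ a) (𝓝[≠] w) (𝓝 0)) →
        Summable (fun n : ℕ => (persistenceProb P X θ n : ℂ) * z ^ n) ∧
        (z ≠ 0 → deformedExp θ (a * z / (1 + a)) ≠ 0 →
          HasSum (fun n : ℕ => (persistenceProb P X θ n : ℂ) * z ^ n)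
            (1 / z * (1 / yellowDenom θ a z - 1)))) ∧
    -- orange region
    (θ ∈ Ioc 0 1 ∧ a ∈ Icc (-θ) 0 →
      ∀ z : ℂ, (∀ w : ℂ, ‖w‖ ≤ ‖z‖ → 1 - w * orangeSeries θ a w ≠ 0) →
        HasSum (fun n : ℕ => (persistenceProb P X θ n : ℂ) * z ^ n)
          (orangeSeries θ a z / (1 - z * orangeSeries θ a z))) ∧
    -- white region
    (θ ∈ Icc (-1) 1 ∧ a ≤ min (-θ) 0 → ∀ n : ℕ, persistenceProb P X θ n = 1) := by
  have hp : ∀ n, persistenceProb P X θ n = ∫ x, persistFrom (cond volume (Icc (-a) 1)) θ n x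
      ∂(cond volume (Icc (-a) 1)) := by
    have := isProbabilityMeasure_cond_Icc ha
    exact persistenceProb_eq_integral hmeas hindep hunif
  simp only [hp]
  refine ⟨fun h z hz0 hz => ?_, fun ⟨⟨hθ1, hθ0⟩, h⟩ z hz0 hz => ?_, fun ⟨hθ, h⟩ z hz => ?_,
    fun ⟨hθ, h⟩ z hz => hasSum_persist_orange hθ ha h.2 hz, fun ⟨_, h⟩ n => ?_⟩
  · have hθ : |θ| ≤ 1 := by
      rcases h with ⟨h, _⟩ | ⟨h, _⟩
      · exact abs_le.2 ⟨by linarith [h.1], h.2⟩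
      · exact abs_le.2 ⟨h.1, by linarith [h.2]⟩
    have hmap : ∀ x ∈ Icc (-a) 1, θ * x ∈ Icc (-a) 1 := by
      rintro x ⟨hx1, hx2⟩
      rcases h with ⟨⟨hθ0, hθ1⟩, ha0⟩ | ⟨⟨hθ1, hθ0⟩, ha1, ha2⟩
      · have h1 := mul_le_mul_of_nonneg_left hx1 hθ0
        have h2 := mul_le_mul_of_nonneg_left hx2 hθ0
        constructor <;> nlinarith
      · have h1 := mul_le_mul_of_nonpos_left hx1 hθ0.le
        have h2 := mul_le_mul_of_nonpos_left hx2 hθ0.le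
        rw [le_div_iff_of_neg hθ0] at ha2
        constructor <;> linarith
    convert hasSum_persist_of_invariant hθ ha le_rfl (by linarith) hmap (by simp) hz0 hz using 1
    simp
  · have hθ : |θ| ≤ 1 := abs_le.2 ⟨hθ1, by linarith⟩
    have hL : -a ≤ 1 / θ := by rw [neg_div] at h; linarith
    have hL' : 1 / θ ≤ θ := by rw [div_le_iff_of_neg hθ0]; nlinarith
    have hmul : θ * (1 / θ) = 1 := mul_one_div_cancel hθ0.ne
    convert hasSum_persist_of_invariant hθ ha hL (by linarith) (fun x hx => ?_) (fun x hx => ?_)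
      hz0 hz using 1
    · have hθC : (θ : ℂ) ≠ 0 := by exact_mod_cast hθ0.ne
      have haC : (1 + a : ℂ) ≠ 0 := by exact_mod_cast (by linarith : 1 + a ≠ 0)
      have e1 : ((θ : ℂ) * a + 1) / (θ * (1 + a)) = (((1 / θ : ℝ) : ℂ) + a) / (1 + a) := by
        push_cast; field_simp; ring
      have e2 : -z / ((θ : ℂ) * (1 + a)) = -(((1 / θ : ℝ) : ℂ) * z) / (1 + a) := by
        push_cast; field_simp
      rw [e1, e2]
    · have h1 := mul_le_mul_of_nonpos_left hx.1 hθ0.le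
      have h2 := mul_le_mul_of_nonpos_left hx.2 hθ0.le
      constructor <;> linarith
    · have h1 := mul_le_mul_of_nonpos_left hx.2.le hθ0.le
      linarith
  · rcases eq_or_ne z 0 with rfl | hz0
    · exact ⟨summable_of_ne_finset_zero (s := {0}) fun n hn => by simp_all,
        fun h => absurd rfl h⟩
    · obtain ⟨S, hS, hval⟩ := hasSum_persist_yellow hθ h hz0 hz
      exact ⟨hS.summable, fun _ hne => hval hne ▸ hS⟩
  · rw [← hp]
    exact persistenceProb_eq_one_of_le P X θ a hmeas hunif h n
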